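/- Let $m,n$ be positive integers. For a linear map $\Phi: M_m(\mathbb{C})\to M_n(\mathbb{C})$ let $\Phi^\dagger: M_n(\mathbb{C})\to M_m(\mathbb{C})$ denote its adjoint with respect to the Hilbert--Schmidt inner products $\langle X,Y\rangle=\operatorname{tr}[X^*Y]$. The map $\Phi$ is called a Schwarz map if $\Phi(X^*X)\ge \Phi(X)^*\Phi(X)$ in the Loewner order for all $X\in M_m(\mathbb{C})$, and sesquiunital if $\Phi(\mathbf 1)=\mathbf 1$ and $\Phi^\dagger(\mathbf 1)=\frac{n}{m}\mathbf 1$. Let $0<s\le 1$ and $s\le r\le 1$, and let $\Phi: M_m(\mathbb{C})\to M_n(\mathbb{C})$ be a sesquiunital Schwarz map. Then for every positive semidefinite $A\in M_n(\mathbb{C})$ and every $B\in M_m(\mathbb{C})$, $$\operatorname{tr}\left[(\Phi(B)^*A^s\Phi(B))^{r/s}\right]\le \left(\frac{n}{m}\right)^{1-r}\operatorname{tr}\left[(B^*\Phi^\dagger(A)^sB)^{r/s}\right],$$ where real powers of positive semidefinite matrices are taken by functional calculus. -/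

import Mathlib

open scoped MatrixOrder ComplexOrder

/-- The adjoint `Φ†` of a linear map `Φ : M_m(ℂ) → M_n(ℂ)` with respect to the Hilbert–Schmidt
inner products `⟨X, Y⟩ = tr (Xᴴ Y)`. Its `(i, j)` entry at `Y` is `⟨Φ (E i j), Y⟩`, where the
`E i j` are the matrix units; `hsAdjoint_spec` and `hsAdjoint_unique` show that it is the adjoint. -/
def hsAdjoint {m n : ℕ} (Φ : Matrix (Fin m) (Fin m) ℂ →ₗ[ℂ] Matrix (Fin n) (Fin n) ℂ) :
    Matrix (Fin n) (Fin n) ℂ →ₗ[ℂ] Matrix (Fin m) (Fin m) ℂ where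
  toFun Y := Matrix.of fun i j => ((Φ (Matrix.single i j 1)).conjTranspose * Y).trace
  map_add' X Y := by
    ext i j
    simp [Matrix.mul_add, Matrix.trace_add]
  map_smul' c Y := by
    ext i j
    simp [Matrix.trace_smul]

theorem hsAdjoint_spec {m n : ℕ} (Φ : Matrix (Fin m) (Fin m) ℂ →ₗ[ℂ] Matrix (Fin n) (Fin n) ℂ)
    (X : Matrix (Fin m) (Fin m) ℂ) (Y : Matrix (Fin n) (Fin n) ℂ) :
    (X.conjTranspose * hsAdjoint Φ Y).trace = ((Φ X).conjTranspose * Y).trace := by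
  induction X using Matrix.induction_on' with
  | h_zero => simp
  | h_add p q hp hq => simp [Matrix.add_mul, Matrix.trace_add, hp, hq]
  | h_std_basis i j c =>
    have h : Matrix.single i j c = c • Matrix.single i j (1 : ℂ) := by simp
    rw [h, map_smul, Matrix.conjTranspose_smul, Matrix.conjTranspose_smul, Matrix.smul_mul,
      Matrix.smul_mul, Matrix.trace_smul, Matrix.trace_smul]
    congr 1
    simp [Matrix.conjTranspose_single, Matrix.trace_single_mul, hsAdjoint]

theorem hsAdjoint_unique {m n : ℕ} (Φ : Matrix (Fin m) (Fin m) ℂ →ₗ[ℂ] Matrix (Fin n) (Fin n) ℂ)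
    (Ψ : Matrix (Fin n) (Fin n) ℂ →ₗ[ℂ] Matrix (Fin m) (Fin m) ℂ)
    (h : ∀ X Y, (X.conjTranspose * Ψ Y).trace = ((Φ X).conjTranspose * Y).trace) :
    Ψ = hsAdjoint Φ := by
  refine LinearMap.ext fun Y => Matrix.ext fun i j => ?_
  have h1 := (h (Matrix.single i j 1) Y).trans (hsAdjoint_spec Φ (Matrix.single i j 1) Y).symm
  simpa [Matrix.conjTranspose_single, Matrix.trace_single_mul] using h1

/-- A linear map is a Schwarz map if `Φ (Xᴴ X) ≥ Φ(X)ᴴ Φ(X)` for all `X`, in the Loewner order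
(`A ≤ B` iff `B - A` is positive semidefinite). -/
def IsSchwarzMap {m n : ℕ} (Φ : Matrix (Fin m) (Fin m) ℂ →ₗ[ℂ] Matrix (Fin n) (Fin n) ℂ) : Prop :=
  ∀ X : Matrix (Fin m) (Fin m) ℂ, (Φ X).conjTranspose * Φ X ≤ Φ (X.conjTranspose * X)

/-- `Φ` is unital: `Φ(1) = 1`. -/
def IsUnital {m n : ℕ} (Φ : Matrix (Fin m) (Fin m) ℂ →ₗ[ℂ] Matrix (Fin n) (Fin n) ℂ) : Prop :=
  Φ 1 = 1

/-- `Φ` is semiunital: `Φ†(1) = (n / m) 1`. -/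
def IsSemiunital {m n : ℕ} (Φ : Matrix (Fin m) (Fin m) ℂ →ₗ[ℂ] Matrix (Fin n) (Fin n) ℂ) : Prop :=
  hsAdjoint Φ 1 = ((n : ℂ) / (m : ℂ)) • (1 : Matrix (Fin m) (Fin m) ℂ)

/-- `Φ` is sesquiunital: unital and semiunital. -/
def IsSesquiunital {m n : ℕ} (Φ : Matrix (Fin m) (Fin m) ℂ →ₗ[ℂ] Matrix (Fin n) (Fin n) ℂ) :
    Prop :=
  IsUnital Φ ∧ IsSemiunital Φ

/-! The engine is monotonicity of Lieb's trace function: for every positive semidefinite `C`,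
`tr[Φ(B)ᴴ A^s Φ(B) C^(1-s)] ≤ tr[Bᴴ Φ†(A)^s B Φ†(C)^(1-s)]` (`IsSchwarzMap.trace_rpow_mul_rpow_le`).
In eigenbases of the two matrices the form involves only the scalars `a^s c^(1-s)`, which up to a
constant are integrals over `t > 0` of `t^(s-1) · ac/(a+tc)`. The parallel sum `ac/(a+tc)` is the
minimal cost of splitting a number `k = x + y` with cost `t⁻¹a|x|² + c|y|²`. The Schwarz inequality
controls each of the two costs separately, and mapping an optimal splitting of `B` by `Φ` gives an
admissible splitting of `Φ(B)`.

Let `X = Φ(B)ᴴ A^s Φ(B)`, `Y = Bᴴ Φ†(A)^s B` and `p = r/s > 1`, with conjugate exponent `p'`. Taking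
`C` to be the power of `X` with `C^(1-s) = X^(p-1)` turns the left side into `tr X^p`. Hölder bounds
the right side by `(tr Y^p)^(1/p) (tr Φ†(C)^q)^(1/p')` with `q = (1-s)p'`. Jensen
(`IsSchwarzMap.trace_hsAdjoint_rpow_le`) gives `tr Φ†(C)^q ≤ (n/m)^(q-1) tr C^q`, and `C^q = X^p`;
solving for `tr X^p` yields the claim. -/

/-! ### Spectral decompositions and Hölder's inequality for traces -/

section SpectralForm

variable {ι : Type*} [Fintype ι] [DecidableEq ι]

/-- The matrix with eigenvalues `a` in the basis given by the columns of `U`. -/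
noncomputable def unitaryConjDiagonal (U : Matrix ι ι ℂ) (a : ι → ℝ) : Matrix ι ι ℂ :=
  U * Matrix.diagonal (fun i => (a i : ℂ)) * U.conjTranspose

theorem unitaryConjDiagonal_one {U : Matrix ι ι ℂ} (hU : U * U.conjTranspose = 1) :
    unitaryConjDiagonal U 1 = 1 := by
  simp [unitaryConjDiagonal, hU]

theorem Matrix.PosSemidef.exists_rpow_eq_unitaryConjDiagonal {A : Matrix ι ι ℂ}
    (hA : A.PosSemidef) :
    ∃ (U : Matrix ι ι ℂ) (a : ι → ℝ), U.conjTranspose * U = 1 ∧ U * U.conjTranspose = 1 ∧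
      (∀ i, 0 ≤ a i) ∧ A = unitaryConjDiagonal U a ∧
      ∀ s : ℝ, A ^ s = unitaryConjDiagonal U fun i => a i ^ s := by
  have hpow (s : ℝ) : A ^ s = unitaryConjDiagonal (hA.1.eigenvectorUnitary : Matrix ι ι ℂ)
      fun i => hA.1.eigenvalues i ^ s := by
    rw [CFC.rpow_eq_cfc_real (Matrix.nonneg_iff_posSemidef.2 hA), hA.1.cfc_eq,
      Matrix.IsHermitian.cfc, Unitary.conjStarAlgAut_apply]
    rfl
  refine ⟨hA.1.eigenvectorUnitary, hA.1.eigenvalues,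
    Unitary.coe_star_mul_self hA.1.eigenvectorUnitary,
    Unitary.coe_mul_star_self hA.1.eigenvectorUnitary, hA.eigenvalues_nonneg, ?_, hpow⟩
  have h := hpow 1
  rw [CFC.rpow_one A (Matrix.nonneg_iff_posSemidef.2 hA)] at h
  simpa using h

theorem Matrix.PosSemidef.rpow {A : Matrix ι ι ℂ} (s : ℝ) : (A ^ s).PosSemidef :=
  Matrix.nonneg_iff_posSemidef.1 CFC.rpow_nonneg

theorem trace_unitaryConjDiagonal {U : Matrix ι ι ℂ} (hU : U.conjTranspose * U = 1) (a : ι → ℝ) :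
    (unitaryConjDiagonal U a).trace.re = ∑ i, a i := by
  rw [unitaryConjDiagonal, Matrix.trace_mul_comm, ← Matrix.mul_assoc, hU, Matrix.one_mul,
    Matrix.trace_diagonal]
  simp

theorem unitaryConjDiagonal_mul {U : Matrix ι ι ℂ} (hU : U.conjTranspose * U = 1) (a b : ι → ℝ) :
    unitaryConjDiagonal U a * unitaryConjDiagonal U b = unitaryConjDiagonal U (a * b) := by
  have h : unitaryConjDiagonal U a * unitaryConjDiagonal U b =
      U * Matrix.diagonal (fun i => (a i : ℂ)) * (U.conjTranspose * U) *
        Matrix.diagonal (fun i => (b i : ℂ)) * U.conjTranspose := by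
    simp only [unitaryConjDiagonal, Matrix.mul_assoc]
  rw [h, hU, Matrix.mul_one, Matrix.mul_assoc U, Matrix.diagonal_mul_diagonal,
    unitaryConjDiagonal]
  simp

theorem trace_conjTranspose_mul_diagonal_mul_diagonal (W : Matrix ι ι ℂ) (a c : ι → ℝ) :
    (W.conjTranspose * Matrix.diagonal (fun i => (a i : ℂ)) * W *
      Matrix.diagonal (fun i => (c i : ℂ))).trace.re =
      ∑ i, ∑ j, a i * c j * Complex.normSq (W i j) := by
  rw [Matrix.trace, Complex.re_sum, Finset.sum_comm]
  refine Finset.sum_congr rfl fun j _ => ?_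
  rw [Matrix.diag_apply, Matrix.mul_diagonal, Matrix.mul_apply, Finset.sum_mul, Complex.re_sum]
  refine Finset.sum_congr rfl fun i _ => ?_
  rw [Matrix.mul_diagonal, Matrix.conjTranspose_apply, Complex.normSq_apply]
  simp
  ring

theorem trace_mul_unitaryConjDiagonal_mul (U V K : Matrix ι ι ℂ) (a c : ι → ℝ) :
    (K.conjTranspose * unitaryConjDiagonal U a * K * unitaryConjDiagonal V c).trace.re =
      ∑ i, ∑ j, a i * c j * Complex.normSq ((U.conjTranspose * K * V) i j) := by
  rw [← trace_conjTranspose_mul_diagonal_mul_diagonal]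
  congr 1
  have h : K.conjTranspose * unitaryConjDiagonal U a * K * unitaryConjDiagonal V c =
      (K.conjTranspose * U * Matrix.diagonal (fun i => (a i : ℂ)) * U.conjTranspose * K * V *
        Matrix.diagonal (fun i => (c i : ℂ))) * V.conjTranspose := by
    simp only [unitaryConjDiagonal, Matrix.mul_assoc]
  rw [h, Matrix.trace_mul_comm]
  simp only [Matrix.conjTranspose_mul, Matrix.conjTranspose_conjTranspose, Matrix.mul_assoc]

theorem Matrix.PosSemidef.trace_mul_re_nonneg {A B : Matrix ι ι ℂ} (hA : A.PosSemidef)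
    (hB : B.PosSemidef) : 0 ≤ (A * B).trace.re := by
  obtain ⟨U, a, -, -, ha, hUa, -⟩ := hA.exists_rpow_eq_unitaryConjDiagonal
  obtain ⟨V, b, -, -, hb, hVb, -⟩ := hB.exists_rpow_eq_unitaryConjDiagonal
  have h := trace_mul_unitaryConjDiagonal_mul U V 1 a b
  rw [← hUa, ← hVb, Matrix.conjTranspose_one, Matrix.one_mul, Matrix.mul_one] at h
  rw [h]
  exact Finset.sum_nonneg fun i _ => Finset.sum_nonneg fun j _ =>
    mul_nonneg (mul_nonneg (ha i) (hb j)) (Complex.normSq_nonneg _)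

theorem trace_mul_le_trace_mul_of_le {A B C : Matrix ι ι ℂ} (hA : A.PosSemidef) (hBC : B ≤ C) :
    (A * B).trace.re ≤ (A * C).trace.re := by
  have h := hA.trace_mul_re_nonneg (Matrix.le_iff.1 hBC)
  rw [Matrix.mul_sub, Matrix.trace_sub, Complex.sub_re] at h
  linarith

theorem sum_normSq_row {W : Matrix ι ι ℂ} (hW : W * W.conjTranspose = 1) (i : ι) :
    ∑ j, Complex.normSq (W i j) = 1 := by
  have h := congrFun (congrFun hW i) i
  rw [Matrix.mul_apply, Matrix.one_apply_eq] at h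
  simp only [Matrix.conjTranspose_apply, Complex.star_def, Complex.mul_conj] at h
  exact_mod_cast h

theorem sum_normSq_col {W : Matrix ι ι ℂ} (hW : W.conjTranspose * W = 1) (j : ι) :
    ∑ i, Complex.normSq (W i j) = 1 := by
  have h := congrFun (congrFun hW j) j
  rw [Matrix.mul_apply, Matrix.one_apply_eq] at h
  simp only [Matrix.conjTranspose_apply, Complex.star_def, mul_comm (starRingEnd ℂ _),
    Complex.mul_conj] at h
  exact_mod_cast h

/-- **Hölder's inequality** for the trace of a product of positive semidefinite matrices. -/
theorem Matrix.PosSemidef.trace_mul_le_rpow_mul_rpow {Y D : Matrix ι ι ℂ} (hY : Y.PosSemidef)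
    (hD : D.PosSemidef) {p q : ℝ} (hpq : p.HolderConjugate q) :
    (Y * D).trace.re ≤ (Y ^ p).trace.re ^ (1 / p) * (D ^ q).trace.re ^ (1 / q) := by
  obtain ⟨U, y, hU, hU', hy, hUy, hYp⟩ := hY.exists_rpow_eq_unitaryConjDiagonal
  obtain ⟨V, d, hV, hV', hd, hVd, hDq⟩ := hD.exists_rpow_eq_unitaryConjDiagonal
  have h := trace_mul_unitaryConjDiagonal_mul U V 1 y d
  rw [← hUy, ← hVd, Matrix.conjTranspose_one, Matrix.one_mul, Matrix.mul_one, Matrix.mul_one] at h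
  rw [h, hYp, hDq, trace_unitaryConjDiagonal hU, trace_unitaryConjDiagonal hV]
  set W := U.conjTranspose * V with hWdef
  have hW : W * W.conjTranspose = 1 := by
    rw [hWdef, Matrix.conjTranspose_mul, Matrix.conjTranspose_conjTranspose, Matrix.mul_assoc,
      ← Matrix.mul_assoc V, hV', Matrix.one_mul, hU]
  have hW' : W.conjTranspose * W = 1 := by
    rw [hWdef, Matrix.conjTranspose_mul, Matrix.conjTranspose_conjTranspose, Matrix.mul_assoc,
      ← Matrix.mul_assoc U, hU', Matrix.one_mul, hV]
  have hw (i j : ι) : 0 ≤ Complex.normSq (W i j) := Complex.normSq_nonneg _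
  -- The squared moduli of the entries of the unitary `W` are doubly stochastic; splitting each as
  -- its powers `1/p` and `1/q` reduces the claim to scalar Hölder on pairs of indices.
  have key := Real.inner_le_Lp_mul_Lq_of_nonneg (Finset.univ : Finset (ι × ι))
    (f := fun x => y x.1 * Complex.normSq (W x.1 x.2) ^ (1 / p))
    (g := fun x => d x.2 * Complex.normSq (W x.1 x.2) ^ (1 / q)) hpq
    (fun x _ => mul_nonneg (hy _) (Real.rpow_nonneg (hw _ _) _))
    (fun x _ => mul_nonneg (hd _) (Real.rpow_nonneg (hw _ _) _))
  simp only [Fintype.sum_prod_type] at key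
  have e1 (i j : ι) : y i * Complex.normSq (W i j) ^ (1 / p) *
      (d j * Complex.normSq (W i j) ^ (1 / q)) = y i * d j * Complex.normSq (W i j) := by
    have : Complex.normSq (W i j) ^ (1 / p) * Complex.normSq (W i j) ^ (1 / q) =
        Complex.normSq (W i j) := by
      rw [one_div, one_div, ← Real.rpow_add' (hw i j) (by simp [hpq.inv_add_inv_eq_one]),
        hpq.inv_add_inv_eq_one, Real.rpow_one]
    rw [mul_mul_mul_comm, this]
  have e2 (i j : ι) : (y i * Complex.normSq (W i j) ^ (1 / p)) ^ p =
      y i ^ p * Complex.normSq (W i j) := by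
    rw [Real.mul_rpow (hy i) (Real.rpow_nonneg (hw _ _) _), ← Real.rpow_mul (hw _ _),
      one_div_mul_cancel hpq.ne_zero, Real.rpow_one]
  have e3 (i j : ι) : (d j * Complex.normSq (W i j) ^ (1 / q)) ^ q =
      d j ^ q * Complex.normSq (W i j) := by
    rw [Real.mul_rpow (hd j) (Real.rpow_nonneg (hw _ _) _), ← Real.rpow_mul (hw _ _),
      one_div_mul_cancel hpq.symm.ne_zero, Real.rpow_one]
  simp only [e1, e2, e3] at key
  rw [Finset.sum_comm (f := fun i j => d j ^ q * Complex.normSq (W i j))] at key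
  simpa only [← Finset.mul_sum, sum_normSq_row hW, sum_normSq_col hW', mul_one] using key

end SpectralForm

/-! ### Positivity of Schwarz maps and the two endpoint trace inequalities -/

section SchwarzMap

variable {m n : ℕ} {Φ : Matrix (Fin m) (Fin m) ℂ →ₗ[ℂ] Matrix (Fin n) (Fin n) ℂ}

theorem IsSchwarzMap.posSemidef (hΦ : IsSchwarzMap Φ) (X : Matrix (Fin m) (Fin m) ℂ) :
    (Φ (X.conjTranspose * X)).PosSemidef :=
  Matrix.nonneg_iff_posSemidef.1
    ((Matrix.nonneg_iff_posSemidef.2 (Matrix.posSemidef_conjTranspose_mul_self (Φ X))).trans (hΦ X))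

/-- Polarization: expanding `Φ((1+Z)ᴴ(1+Z))`, which is Hermitian, shows that `Φ(Z) + Φ(Zᴴ)` is
Hermitian. Taking `Z = X` and `Z = iX` separates the two terms. -/
theorem IsSchwarzMap.map_conjTranspose (hΦ : IsSchwarzMap Φ) (X : Matrix (Fin m) (Fin m) ℂ) :
    Φ X.conjTranspose = (Φ X).conjTranspose := by
  have key (Z : Matrix (Fin m) (Fin m) ℂ) :
      (Φ Z).conjTranspose + (Φ Z.conjTranspose).conjTranspose = Φ Z + Φ Z.conjTranspose := by
    have h1 := (hΦ.posSemidef (1 + Z)).1.eq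
    have h2 := (hΦ.posSemidef Z).1.eq
    have h3 := (hΦ.posSemidef 1).1.eq
    have e : (1 + Z).conjTranspose * (1 + Z) =
        1 + (Z + Z.conjTranspose) + Z.conjTranspose * Z := by
      rw [Matrix.conjTranspose_add, Matrix.conjTranspose_one]; noncomm_ring
    rw [Matrix.conjTranspose_one, Matrix.one_mul] at h3
    rw [e, map_add, map_add, map_add, Matrix.conjTranspose_add, Matrix.conjTranspose_add,
      Matrix.conjTranspose_add, h2, h3] at h1
    exact add_left_cancel (add_right_cancel h1)
  have h1 := key X
  have h2 := key (Complex.I • X)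
  simp only [Matrix.conjTranspose_smul, map_smul, Complex.star_def, Complex.conj_I, neg_smul,
    map_neg, Matrix.conjTranspose_neg, neg_neg] at h2
  ext i j
  have h1' := congrFun (congrFun h1 i) j
  have h2' := congrFun (congrFun h2 i) j
  simp only [Matrix.add_apply, Matrix.neg_apply, Matrix.smul_apply, smul_eq_mul] at h1' h2'
  have h2'' : (Φ X).conjTranspose i j - (Φ X.conjTranspose).conjTranspose i j =
      -Φ X i j + Φ X.conjTranspose i j := by
    refine mul_left_cancel₀ Complex.I_ne_zero ?_
    linear_combination -h2'
  linear_combination (-1 / 2 : ℂ) * h1' + (-1 / 2 : ℂ) * h2''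

theorem IsSchwarzMap.mul_conjTranspose_le (hΦ : IsSchwarzMap Φ) (X : Matrix (Fin m) (Fin m) ℂ) :
    Φ X * (Φ X).conjTranspose ≤ Φ (X * X.conjTranspose) := by
  have h := hΦ X.conjTranspose
  rwa [hΦ.map_conjTranspose, Matrix.conjTranspose_conjTranspose,
    Matrix.conjTranspose_conjTranspose] at h

theorem IsSchwarzMap.trace_hsAdjoint_mul (hΦ : IsSchwarzMap Φ) (X : Matrix (Fin m) (Fin m) ℂ)
    (Y : Matrix (Fin n) (Fin n) ℂ) : (hsAdjoint Φ Y * X).trace = (Y * Φ X).trace := by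
  have h := hsAdjoint_spec Φ X.conjTranspose Y
  rw [hΦ.map_conjTranspose, Matrix.conjTranspose_conjTranspose,
    Matrix.conjTranspose_conjTranspose] at h
  rw [Matrix.trace_mul_comm, h, Matrix.trace_mul_comm]

theorem IsSchwarzMap.posSemidef_hsAdjoint (hΦ : IsSchwarzMap Φ) {A : Matrix (Fin n) (Fin n) ℂ}
    (hA : A.PosSemidef) : (hsAdjoint Φ A).PosSemidef := by
  refine Matrix.PosSemidef.of_dotProduct_mulVec_nonneg ?_ fun v => ?_
  · ext i j
    have hs : Matrix.single j i (1 : ℂ) = (Matrix.single i j 1).conjTranspose := by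
      simp [Matrix.conjTranspose_single]
    simp only [hsAdjoint, Matrix.conjTranspose_apply, LinearMap.coe_mk, AddHom.coe_mk,
      Matrix.of_apply]
    rw [← Matrix.trace_conjTranspose, Matrix.conjTranspose_mul, hA.1.eq,
      Matrix.conjTranspose_conjTranspose, hs, hΦ.map_conjTranspose, Matrix.trace_mul_comm]
  -- The quadratic form at `v` is the trace of `A` against the image of the positive rank-one matrix
  -- `v vᴴ`.
  · have h : star v ⬝ᵥ (hsAdjoint Φ A).mulVec v =
        (A * Φ (Matrix.vecMulVec v (star v))).trace := by
      rw [← hΦ.trace_hsAdjoint_mul, Matrix.mul_vecMulVec, Matrix.trace_vecMulVec, dotProduct_comm]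
    have hv : (Φ (Matrix.vecMulVec v (star v))).PosSemidef := by
      obtain ⟨M, hM⟩ := CStarAlgebra.nonneg_iff_eq_star_mul_self.1
        (Matrix.nonneg_iff_posSemidef.2 (Matrix.posSemidef_vecMulVec_self_star v))
      rw [hM]
      exact hΦ.posSemidef M
    rw [h]
    obtain ⟨M, hM⟩ := CStarAlgebra.nonneg_iff_eq_star_mul_self.1
        (Matrix.nonneg_iff_posSemidef.2 hA)
    rw [hM, Matrix.mul_assoc, Matrix.trace_mul_comm]
    exact (hv.mul_mul_conjTranspose_same M).trace_nonneg

/-- The case of exponents `1` and `0` of the monotonicity of Lieb's trace function. -/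
theorem IsSchwarzMap.trace_left_le (hΦ : IsSchwarzMap Φ) {A : Matrix (Fin n) (Fin n) ℂ}
    (hA : A.PosSemidef) (X : Matrix (Fin m) (Fin m) ℂ) :
    ((Φ X).conjTranspose * A * Φ X).trace.re ≤
      (X.conjTranspose * hsAdjoint Φ A * X).trace.re := by
  have h := trace_mul_le_trace_mul_of_le hA (hΦ.mul_conjTranspose_le X)
  rwa [← hΦ.trace_hsAdjoint_mul, ← Matrix.mul_assoc, ← Matrix.mul_assoc,
    Matrix.trace_mul_comm _ (Φ X).conjTranspose, Matrix.trace_mul_comm _ X.conjTranspose,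
    ← Matrix.mul_assoc, ← Matrix.mul_assoc] at h

/-- The case of exponents `0` and `1` of the monotonicity of Lieb's trace function. -/
theorem IsSchwarzMap.trace_right_le (hΦ : IsSchwarzMap Φ) {C : Matrix (Fin n) (Fin n) ℂ}
    (hC : C.PosSemidef) (X : Matrix (Fin m) (Fin m) ℂ) :
    ((Φ X).conjTranspose * Φ X * C).trace.re ≤
      (X.conjTranspose * X * hsAdjoint Φ C).trace.re := by
  have h := trace_mul_le_trace_mul_of_le hC (hΦ X)
  rw [← hΦ.trace_hsAdjoint_mul] at h
  rwa [Matrix.trace_mul_comm, Matrix.trace_mul_comm _ (hsAdjoint Φ C)]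

end SchwarzMap

/-! ### Scalar parallel sums and their integral representation -/

section ParallelSum

/-- After clearing denominators the defect is `|tcy - ax|²`. If `a + tc = 0`, the quotient takes its
default value `0`. -/
theorem parallelSum_mul_normSq_add_le {a c t : ℝ} (ha : 0 ≤ a) (hc : 0 ≤ c) (ht : 0 < t)
    (x y : ℂ) :
    a * c / (a + t * c) * Complex.normSq (x + y) ≤
      t⁻¹ * (a * Complex.normSq x) + c * Complex.normSq y := by
  rcases (add_nonneg ha (mul_nonneg ht.le hc)).eq_or_lt' with h0 | h0
  · rw [h0, div_zero, zero_mul]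
    have := Complex.normSq_nonneg x
    have := Complex.normSq_nonneg y
    positivity
  · rw [div_mul_eq_mul_div, div_le_iff₀ h0]
    refine le_of_mul_le_mul_left ?_ ht
    have e : t * ((t⁻¹ * (a * Complex.normSq x) + c * Complex.normSq y) * (a + t * c)) =
        (a * Complex.normSq x + t * c * Complex.normSq y) * (a + t * c) := by
      field_simp
    rw [e]
    simp only [Complex.normSq_apply, Complex.add_re, Complex.add_im]
    nlinarith [sq_nonneg (t * c * y.re - a * x.re), sq_nonneg (t * c * y.im - a * x.im)]

/-- Equality in the preceding bound requires `ax = tcy`, which together with `x + y = k` determines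
the weights. -/
theorem exists_add_eq_parallelSum_mul_normSq {a c t : ℝ} (ha : 0 ≤ a) (hc : 0 ≤ c) (ht : 0 < t)
    (k : ℂ) : ∃ x y : ℂ, x + y = k ∧
      t⁻¹ * (a * Complex.normSq x) + c * Complex.normSq y =
        a * c / (a + t * c) * Complex.normSq k := by
  rcases (add_nonneg ha (mul_nonneg ht.le hc)).eq_or_lt' with h0 | h0
  · have hc0 : c = 0 := by nlinarith [mul_nonneg ht.le hc]
    exact ⟨0, k, by simp, by simp [hc0]⟩
  · refine ⟨((t * c / (a + t * c) : ℝ) : ℂ) * k, ((a / (a + t * c) : ℝ) : ℂ) * k, ?_, ?_⟩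
    · rw [← add_mul, ← Complex.ofReal_add, ← add_div, add_comm (t * c), div_self h0.ne']
      simp
    · rw [Complex.normSq_mul, Complex.normSq_mul, Complex.normSq_ofReal, Complex.normSq_ofReal]
      field_simp
      ring

theorem mul_rpowIntegrand_div {s t a c : ℝ} (hs : s ∈ Set.Ioo 0 1) (ht : 0 < t) (ha : 0 ≤ a)
    (hc : 0 ≤ c) :
    c * Real.rpowIntegrand₀₁ s t (a / c) = t ^ (s - 1) * (a * c / (a + t * c)) := by
  rcases hc.eq_or_lt' with rfl | hc
  · simp
  · rw [Real.rpowIntegrand₀₁_eq_pow_div hs ht.le (by positivity)]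
    have : t + a / c = (a + t * c) / c := by field_simp; ring
    rw [this]
    have : 0 < a + t * c := by positivity
    field_simp

open MeasureTheory in
theorem integral_mul_rpowIntegrand_div {s a c : ℝ} (hs : s ∈ Set.Ioo 0 1) (ha : 0 ≤ a)
    (hc : 0 ≤ c) :
    ∫ t in Set.Ioi 0, c * Real.rpowIntegrand₀₁ s t (a / c) =
      a ^ s * c ^ (1 - s) * ∫ t in Set.Ioi 0, Real.rpowIntegrand₀₁ s t 1 := by
  rw [integral_const_mul, Real.integral_rpowIntegrand₀₁_eq_rpow_mul_const hs (by positivity),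
    ← mul_assoc]
  congr 1
  rcases hc.eq_or_lt' with rfl | hc
  · rw [Real.zero_rpow (by linarith [hs.2])]
    simp
  · rw [Real.div_rpow ha hc.le, Real.rpow_sub hc, Real.rpow_one]
    ring

end ParallelSum

/-! ### Monotonicity of Lieb's trace function -/

section Lieb

variable {m n : ℕ} {Φ : Matrix (Fin m) (Fin m) ℂ →ₗ[ℂ] Matrix (Fin n) (Fin n) ℂ}

/-- Monotonicity of parallel sums of left and right multiplications under a Schwarz map. -/
theorem IsSchwarzMap.sum_parallelSum_le (hΦ : IsSchwarzMap Φ)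
    {U V : Matrix (Fin n) (Fin n) ℂ} {P Q : Matrix (Fin m) (Fin m) ℂ}
    {a c : Fin n → ℝ} {α γ : Fin m → ℝ}
    (hU : U * U.conjTranspose = 1) (hV : V * V.conjTranspose = 1)
    (hP : P.conjTranspose * P = 1) (hP' : P * P.conjTranspose = 1)
    (hQ : Q.conjTranspose * Q = 1) (hQ' : Q * Q.conjTranspose = 1)
    (ha : ∀ i, 0 ≤ a i) (hc : ∀ i, 0 ≤ c i) (hα : ∀ i, 0 ≤ α i) (hγ : ∀ i, 0 ≤ γ i)
    (hA : (unitaryConjDiagonal U a).PosSemidef) (hC : (unitaryConjDiagonal V c).PosSemidef)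
    (hΦA : hsAdjoint Φ (unitaryConjDiagonal U a) = unitaryConjDiagonal P α)
    (hΦC : hsAdjoint Φ (unitaryConjDiagonal V c) = unitaryConjDiagonal Q γ)
    {t : ℝ} (ht : 0 < t) (B : Matrix (Fin m) (Fin m) ℂ) :
    ∑ i, ∑ j, a i * c j / (a i + t * c j) *
        Complex.normSq ((U.conjTranspose * Φ B * V) i j) ≤
      ∑ i, ∑ j, α i * γ j / (α i + t * γ j) *
        Complex.normSq ((P.conjTranspose * B * Q) i j) := by
  set Z := P.conjTranspose * B * Q with hZ
  -- Each entry of `Pᴴ B Q` is split optimally; back in the original basis this gives `B = X + Y`.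
  -- The images `Φ X` and `Φ Y` need not split `Φ B` optimally, which is the source of the
  -- inequality.
  choose x y hxy heq using fun i j =>
    exists_add_eq_parallelSum_mul_normSq (hα i) (hγ j) ht (Z i j)
  set X := P * Matrix.of x * Q.conjTranspose with hX
  set Y := P * Matrix.of y * Q.conjTranspose with hY
  have hcancel (M : Matrix (Fin m) (Fin m) ℂ) :
      P.conjTranspose * (P * M * Q.conjTranspose) * Q = M := by
    calc _ = (P.conjTranspose * P) * M * (Q.conjTranspose * Q) := by
          simp only [Matrix.mul_assoc]
      _ = M := by rw [hP, hQ, Matrix.one_mul, Matrix.mul_one]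
  have hB : X + Y = B := by
    have e : Matrix.of x + Matrix.of y = Z := by ext i j; exact hxy i j
    calc X + Y = P * (Matrix.of x + Matrix.of y) * Q.conjTranspose := by
          rw [hX, hY, Matrix.mul_add, Matrix.add_mul]
      _ = (P * P.conjTranspose) * B * (Q * Q.conjTranspose) := by
          rw [e, hZ]; simp only [Matrix.mul_assoc]
      _ = B := by rw [hP', hQ', Matrix.one_mul, Matrix.mul_one]
  have h1 := hΦ.trace_left_le hA X
  have h2 := hΦ.trace_right_le hC Y
  have e1 := trace_mul_unitaryConjDiagonal_mul U V (Φ X) a 1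
  have e2 := trace_mul_unitaryConjDiagonal_mul P Q X α 1
  have e3 := trace_mul_unitaryConjDiagonal_mul U V (Φ Y) 1 c
  have e4 := trace_mul_unitaryConjDiagonal_mul P Q Y 1 γ
  rw [unitaryConjDiagonal_one hV, Matrix.mul_one] at e1
  rw [unitaryConjDiagonal_one hQ', Matrix.mul_one, ← hΦA, hX, hcancel, ← hX] at e2
  rw [unitaryConjDiagonal_one hU, Matrix.mul_one] at e3
  rw [unitaryConjDiagonal_one hP', Matrix.mul_one, ← hΦC, hY, hcancel, ← hY] at e4
  rw [e1, e2] at h1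
  rw [e3, e4] at h2
  simp only [Pi.one_apply, mul_one, one_mul, Matrix.of_apply] at h1 h2
  calc _ ≤ ∑ i, ∑ j, (t⁻¹ * (a i * Complex.normSq ((U.conjTranspose * Φ X * V) i j)) +
        c j * Complex.normSq ((U.conjTranspose * Φ Y * V) i j)) := by
        refine Finset.sum_le_sum fun i _ => Finset.sum_le_sum fun j _ => ?_
        rw [← hB, map_add, Matrix.mul_add, Matrix.add_mul, Matrix.add_apply]
        exact parallelSum_mul_normSq_add_le (ha i) (hc j) ht _ _
    _ ≤ ∑ i, ∑ j, (t⁻¹ * (α i * Complex.normSq (x i j)) + γ j * Complex.normSq (y i j)) := by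
        simp only [Finset.sum_add_distrib, ← Finset.mul_sum] at h1 h2 ⊢
        gcongr
    _ = _ := by simp only [heq]

open MeasureTheory in
theorem integral_sum_parallelSum {ι : Type*} [Fintype ι] {s : ℝ} (hs : s ∈ Set.Ioo 0 1)
    {a c : ι → ℝ} (ha : ∀ i, 0 ≤ a i) (hc : ∀ i, 0 ≤ c i) (w : ι → ι → ℝ) :
    IntegrableOn (fun t => ∑ i, ∑ j, c j * Real.rpowIntegrand₀₁ s t (a i / c j) * w i j)
        (Set.Ioi 0) ∧
      ∫ t in Set.Ioi 0, ∑ i, ∑ j, c j * Real.rpowIntegrand₀₁ s t (a i / c j) * w i j =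
      (∑ i, ∑ j, a i ^ s * c j ^ (1 - s) * w i j) *
        ∫ t in Set.Ioi 0, Real.rpowIntegrand₀₁ s t 1 := by
  have hint (i j : ι) : IntegrableOn
      (fun t => c j * Real.rpowIntegrand₀₁ s t (a i / c j) * w i j) (Set.Ioi 0) :=
    ((Real.integrableOn_rpowIntegrand₀₁_Ioi hs (div_nonneg (ha i) (hc j))).const_mul _).mul_const _
  refine ⟨integrable_finsetSum _ fun i _ => integrable_finsetSum _ fun j _ => hint i j, ?_⟩
  rw [integral_finsetSum _ fun i _ => integrable_finsetSum _ fun j _ => hint i j,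
    Finset.sum_mul]
  refine Finset.sum_congr rfl fun i _ => ?_
  rw [integral_finsetSum _ fun j _ => hint i j, Finset.sum_mul]
  refine Finset.sum_congr rfl fun j _ => ?_
  rw [integral_mul_const, integral_mul_rpowIntegrand_div hs (ha i) (hc j)]
  ring

/-- Monotonicity of Lieb's trace function under Schwarz maps. -/
theorem IsSchwarzMap.trace_rpow_mul_rpow_le (hΦ : IsSchwarzMap Φ) {s : ℝ}
    (hs : s ∈ Set.Ioo 0 1) {A C : Matrix (Fin n) (Fin n) ℂ} (hA : A.PosSemidef)
    (hC : C.PosSemidef) (B : Matrix (Fin m) (Fin m) ℂ) :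
    ((Φ B).conjTranspose * A ^ s * Φ B * C ^ (1 - s)).trace.re ≤
      (B.conjTranspose * hsAdjoint Φ A ^ s * B * hsAdjoint Φ C ^ (1 - s)).trace.re := by
  obtain ⟨U, a, -, hU, ha, hUa, hAs⟩ := hA.exists_rpow_eq_unitaryConjDiagonal
  obtain ⟨V, c, -, hV, hc, hVc, hCs⟩ := hC.exists_rpow_eq_unitaryConjDiagonal
  obtain ⟨P, α, hP, hP', hα, hPα, hΦA⟩ :=
    (hΦ.posSemidef_hsAdjoint hA).exists_rpow_eq_unitaryConjDiagonal
  obtain ⟨Q, γ, hQ, hQ', hγ, hQγ, hΦC⟩ :=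
    (hΦ.posSemidef_hsAdjoint hC).exists_rpow_eq_unitaryConjDiagonal
  rw [hAs, hCs, hΦA, hΦC, trace_mul_unitaryConjDiagonal_mul, trace_mul_unitaryConjDiagonal_mul]
  -- Multiplying by the positive normalizing constant makes both sides integrals over `t`, to be
  -- compared pointwise.
  refine le_of_mul_le_mul_right ?_ (Real.integral_rpowIntegrand₀₁_one_pos hs)
  obtain ⟨i1, e1⟩ := integral_sum_parallelSum hs ha hc
    fun i j => Complex.normSq ((U.conjTranspose * Φ B * V) i j)
  obtain ⟨i2, e2⟩ := integral_sum_parallelSum hs hα hγ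
    fun i j => Complex.normSq ((P.conjTranspose * B * Q) i j)
  rw [← e1, ← e2]
  refine MeasureTheory.setIntegral_mono_on i1 i2 measurableSet_Ioi fun t ht => ?_
  have ht : 0 < t := ht
  have key := hΦ.sum_parallelSum_le hU hV hP hP' hQ hQ' ha hc hα hγ (hUa ▸ hA) (hVc ▸ hC)
    (hUa ▸ hPα) (hVc ▸ hQγ) ht B
  simp only [mul_rpowIntegrand_div hs ht (ha _) (hc _), mul_rpowIntegrand_div hs ht (hα _) (hγ _),
    mul_assoc (t ^ (s - 1)), ← Finset.mul_sum]
  exact mul_le_mul_of_nonneg_left key (Real.rpow_nonneg ht.le _)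

end Lieb

/-! ### Jensen's inequality and power traces of the adjoint -/

section Jensen

/-- **Jensen's inequality** for powers and finite sums whose weights need not add up to one. -/
theorem rpow_sum_mul_le {ι : Type*} [Fintype ι] (w c : ι → ℝ) (hw : ∀ j, 0 ≤ w j) (hc : ∀ j, 0 ≤ c j) {q : ℝ}
    (hq : 1 ≤ q) :
    (∑ j, w j * c j) ^ q ≤ (∑ j, w j) ^ (q - 1) * ∑ j, w j * c j ^ q := by
  have hq0 : 0 < q := by linarith
  have hW : 0 ≤ ∑ j, w j := Finset.sum_nonneg fun j _ => hw j
  have hS : 0 ≤ ∑ j, w j * c j ^ q :=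
    Finset.sum_nonneg fun j _ => mul_nonneg (hw j) (Real.rpow_nonneg (hc j) _)
  have h := Real.rpow_le_rpow (Finset.sum_nonneg fun j _ => mul_nonneg (hw j) (hc j))
    (Real.inner_le_weight_mul_Lp_of_nonneg Finset.univ hq w c hw hc) hq0.le
  rwa [Real.mul_rpow (Real.rpow_nonneg hW _) (Real.rpow_nonneg hS _), ← Real.rpow_mul hW,
    ← Real.rpow_mul hS, inv_mul_cancel₀ hq0.ne', Real.rpow_one, sub_mul, one_mul,
    inv_mul_cancel₀ hq0.ne'] at h

variable {ι : Type*} [Fintype ι] [DecidableEq ι]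

theorem unitaryConjDiagonal_posSemidef (U : Matrix ι ι ℂ) {a : ι → ℝ} (ha : ∀ i, 0 ≤ a i) :
    (unitaryConjDiagonal U a).PosSemidef :=
  (Matrix.PosSemidef.diagonal fun i => Complex.zero_le_real.2 (ha i)).mul_mul_conjTranspose_same U

theorem unitaryConjDiagonal_eq_sum (U : Matrix ι ι ℂ) (a : ι → ℝ) :
    unitaryConjDiagonal U a = ∑ j, (a j : ℂ) • unitaryConjDiagonal U (Pi.single j 1) := by
  have h : Matrix.diagonal (fun i => (a i : ℂ)) =
      ∑ j, (a j : ℂ) • Matrix.diagonal (fun i => (((Pi.single j 1 : ι → ℝ) i : ℝ) : ℂ)) := by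
    ext i k
    rw [Matrix.sum_apply]
    rcases eq_or_ne i k with rfl | hik
    · simp [Pi.single_apply, apply_ite Complex.ofReal]
    · simp [hik]
  simp only [unitaryConjDiagonal, h, Finset.mul_sum, Finset.sum_mul, Matrix.mul_smul,
    Matrix.smul_mul]

theorem conjTranspose_mul_unitaryConjDiagonal_mul {U : Matrix ι ι ℂ}
    (hU : U.conjTranspose * U = 1) (a : ι → ℝ) :
    U.conjTranspose * unitaryConjDiagonal U a * U = Matrix.diagonal fun i => (a i : ℂ) := by
  calc _ = (U.conjTranspose * U) * Matrix.diagonal (fun i => (a i : ℂ)) *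
        (U.conjTranspose * U) := by simp only [unitaryConjDiagonal, Matrix.mul_assoc]
    _ = _ := by rw [hU, Matrix.one_mul, Matrix.mul_one]

variable {m n : ℕ} {Φ : Matrix (Fin m) (Fin m) ℂ →ₗ[ℂ] Matrix (Fin n) (Fin n) ℂ}

/-- The eigenvalues of `Φ†(C)` are nonnegative combinations of those of `C`. Semiunitality makes
each row of weights sum to `n/m`, which gives the Jensen constant; unitality makes each column sum
to `1`. -/
theorem IsSchwarzMap.trace_hsAdjoint_rpow_le (hΦ : IsSchwarzMap Φ) (hΦ1 : IsSesquiunital Φ)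
    {C : Matrix (Fin n) (Fin n) ℂ} (hC : C.PosSemidef) {q : ℝ} (hq : 1 ≤ q) :
    (hsAdjoint Φ C ^ q).trace.re ≤ ((n : ℝ) / m) ^ (q - 1) * (C ^ q).trace.re := by
  obtain ⟨V, c, hV, hV', hc, hVc, hCs⟩ := hC.exists_rpow_eq_unitaryConjDiagonal
  obtain ⟨Q, γ, hQ, hQ', hγ, hQγ, hΦC⟩ :=
    (hΦ.posSemidef_hsAdjoint hC).exists_rpow_eq_unitaryConjDiagonal
  set E : Fin n → Matrix (Fin n) (Fin n) ℂ := fun j => unitaryConjDiagonal V (Pi.single j 1)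
    with hE
  have hEpos (j : Fin n) : (E j).PosSemidef :=
    unitaryConjDiagonal_posSemidef V fun i => by
      by_cases h : i = j <;> simp [h]
  set w : Fin m → Fin n → ℝ := fun l j => (Q.conjTranspose * hsAdjoint Φ (E j) * Q) l l |>.re
    with hwdef
  have hw (l : Fin m) (j : Fin n) : 0 ≤ w l j :=
    (Complex.le_def.1 (((hΦ.posSemidef_hsAdjoint (hEpos j)).conjTranspose_mul_mul_same
      Q).diag_nonneg (i := l))).1
  have hsum (b : Fin n → ℝ) (l : Fin m) :
      ((Q.conjTranspose * hsAdjoint Φ (unitaryConjDiagonal V b) * Q) l l).re =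
        ∑ j, w l j * b j := by
    rw [unitaryConjDiagonal_eq_sum, map_sum, Matrix.mul_sum, Matrix.sum_mul, Matrix.sum_apply,
      Complex.re_sum]
    refine Finset.sum_congr rfl fun j _ => ?_
    rw [map_smul, Matrix.mul_smul, Matrix.smul_mul, Matrix.smul_apply, smul_eq_mul,
      Complex.re_ofReal_mul, mul_comm]
  have hγw (l : Fin m) : γ l = ∑ j, w l j * c j := by
    rw [← hsum, ← hVc, hQγ, conjTranspose_mul_unitaryConjDiagonal_mul hQ]
    simp
  have hrow (l : Fin m) : ∑ j, w l j = (n : ℝ) / m := by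
    have h := hsum 1 l
    have hs : hsAdjoint Φ 1 = ((n : ℂ) / (m : ℂ)) • (1 : Matrix (Fin m) (Fin m) ℂ) := hΦ1.2
    rw [unitaryConjDiagonal_one hV', hs, Matrix.mul_smul, Matrix.mul_one, Matrix.smul_mul,
      hQ] at h
    simp only [Pi.one_apply, mul_one] at h
    rw [← h, Matrix.smul_apply, Matrix.one_apply_eq, smul_eq_mul, mul_one]
    rw [← Complex.ofReal_natCast, ← Complex.ofReal_natCast, ← Complex.ofReal_div,
      Complex.ofReal_re]
  have hcol (j : Fin n) : ∑ l, w l j = 1 := by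
    have h1 : Φ 1 = 1 := hΦ1.1
    have h2 : (hsAdjoint Φ (E j)).trace = (E j).trace := by
      simpa [h1] using hΦ.trace_hsAdjoint_mul 1 (E j)
    have h3 : (Q.conjTranspose * hsAdjoint Φ (E j) * Q).trace = (E j).trace := by
      rw [Matrix.mul_assoc, Matrix.trace_mul_comm, Matrix.mul_assoc, hQ', Matrix.mul_one, h2]
    have h4 := congrArg Complex.re h3
    rw [Matrix.trace, Complex.re_sum, trace_unitaryConjDiagonal hV] at h4
    simpa [hwdef] using h4
  rw [hΦC, hCs, trace_unitaryConjDiagonal hQ, trace_unitaryConjDiagonal hV]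
  calc ∑ l, γ l ^ q ≤ ∑ l, ((n : ℝ) / m) ^ (q - 1) * ∑ j, w l j * c j ^ q := by
        refine Finset.sum_le_sum fun l _ => ?_
        rw [hγw, ← hrow l]
        exact rpow_sum_mul_le (w l) c (hw l) hc hq
    _ = ((n : ℝ) / m) ^ (q - 1) * ∑ j, c j ^ q := by
        rw [← Finset.mul_sum, Finset.sum_comm]
        simp only [← Finset.sum_mul, hcol, one_mul]

end Jensen

/-! ### Choice of exponents and conclusion -/

theorem Matrix.PosSemidef.trace_rpow_re_nonneg {ι : Type*} [Fintype ι] [DecidableEq ι]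
    (X : Matrix ι ι ℂ) (p : ℝ) : 0 ≤ (X ^ p).trace.re :=
  (Complex.le_def.1 (Matrix.PosSemidef.rpow (A := X) p).trace_nonneg).1

theorem Matrix.PosSemidef.mul_rpow_sub_one {ι : Type*} [Fintype ι] [DecidableEq ι]
    {X : Matrix ι ι ℂ} (hX : X.PosSemidef) {p : ℝ} (hp : p ≠ 0) : X * X ^ (p - 1) = X ^ p := by
  obtain ⟨U, x, hU, -, hx, hUx, hXs⟩ := hX.exists_rpow_eq_unitaryConjDiagonal
  rw [hXs, hXs]
  nth_rewrite 1 [hUx]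
  rw [unitaryConjDiagonal_mul hU]
  congr 1
  ext i
  rw [Pi.mul_apply]
  have h := Real.rpow_add' (hx i) (y := 1) (z := p - 1) (by simpa using hp)
  rw [Real.rpow_one, add_sub_cancel] at h
  exact h.symm

/-- Raising the hypothesis to the power `p` gives `T^p ≤ S · N^(1-r) · T^(p-1)`, since `p/p' = p -
1` and `(q-1)(p-1) = 1 - r`; for `T > 0` the factor `T^(p-1)` cancels. -/
theorem le_mul_rpow_of_le_holder {T S N p p' q r s : ℝ} (hs : 0 < s) (hsr : s < r)
    (hp : p = r / s) (hp' : p' = r / (r - s)) (hq : q = (1 - s) * r / (r - s)) (hN : 0 < N)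
    (hT : 0 ≤ T) (hS : 0 ≤ S)
    (h : T ≤ S ^ (1 / p) * (N ^ (q - 1) * T) ^ (1 / p')) : T ≤ N ^ (1 - r) * S := by
  have hrs : 0 < r - s := by linarith
  have hr : 0 < r := by linarith
  rcases hT.eq_or_lt with rfl | hT
  · exact mul_nonneg (Real.rpow_nonneg hN.le _) hS
  have hp0 : 0 < p := hp ▸ div_pos hr hs
  have hR : 0 ≤ N ^ (q - 1) * T := mul_nonneg (Real.rpow_nonneg hN.le _) hT.le
  have h1 := Real.rpow_le_rpow hT.le h hp0.le
  have e1 : 1 / p' * p = p - 1 := by rw [hp, hp']; field_simp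
  have e2 : (q - 1) * (p - 1) = 1 - r := by rw [hp, hq]; field_simp; ring
  rw [Real.mul_rpow (Real.rpow_nonneg hS _) (Real.rpow_nonneg hR _), ← Real.rpow_mul hS,
    one_div_mul_cancel hp0.ne', Real.rpow_one, ← Real.rpow_mul hR, e1,
    Real.mul_rpow (Real.rpow_nonneg hN.le _) hT.le, ← Real.rpow_mul hN.le, e2] at h1
  have e3 : T ^ p = T * T ^ (p - 1) := by
    rw [Real.rpow_sub_one hT.ne', mul_div_cancel₀ _ hT.ne']
  refine le_of_mul_le_mul_right ?_ (Real.rpow_pos_of_pos hT (p - 1))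
  rw [← e3]
  linarith

theorem theorem3p3 {m n : ℕ} (hm : 0 < m) (hn : 0 < n) {s r : ℝ}
    (hs : 0 < s) (hs1 : s ≤ 1) (hsr : s ≤ r) (hr1 : r ≤ 1)
    (Φ : Matrix (Fin m) (Fin m) ℂ →ₗ[ℂ] Matrix (Fin n) (Fin n) ℂ)
    (hΦ : IsSchwarzMap Φ) (hΦ1 : IsSesquiunital Φ)
    (A : Matrix (Fin n) (Fin n) ℂ) (hA : A.PosSemidef) (B : Matrix (Fin m) (Fin m) ℂ) :
    (((Φ B).conjTranspose * A ^ s * Φ B) ^ (r / s)).trace.re ≤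
      ((n : ℝ) / (m : ℝ)) ^ (1 - r) *
        ((B.conjTranspose * (hsAdjoint Φ A) ^ s * B) ^ (r / s)).trace.re := by
  have hN : (0 : ℝ) < n / m := by positivity
  have hX : ((Φ B).conjTranspose * A ^ s * Φ B).PosSemidef :=
    (Matrix.PosSemidef.rpow s).conjTranspose_mul_mul_same _
  have hY : (B.conjTranspose * (hsAdjoint Φ A) ^ s * B).PosSemidef :=
    (Matrix.PosSemidef.rpow s).conjTranspose_mul_mul_same _
  -- For `r = s` the exponent `p'` would be infinite, and Lieb monotonicity with `C = 1` suffices,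
  -- `Φ†(1)^(1-s)` being the scalar `(n/m)^(1-s)`. At `s = 1` the endpoint inequality replaces it.
  rcases hsr.eq_or_lt with rfl | hsr
  · rw [div_self hs.ne', CFC.rpow_one _ (Matrix.nonneg_iff_posSemidef.2 hX),
      CFC.rpow_one _ (Matrix.nonneg_iff_posSemidef.2 hY)]
    rcases hs1.eq_or_lt with rfl | hs1
    · rw [CFC.rpow_one _ (Matrix.nonneg_iff_posSemidef.2 hA),
        CFC.rpow_one _ (Matrix.nonneg_iff_posSemidef.2 (hΦ.posSemidef_hsAdjoint hA)), sub_self,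
        Real.rpow_zero, one_mul]
      exact hΦ.trace_left_le hA B
    · have h := hΦ.trace_rpow_mul_rpow_le ⟨hs, hs1⟩ hA Matrix.PosSemidef.one B
      have e : hsAdjoint Φ 1 =
          algebraMap NNReal (Matrix (Fin m) (Fin m) ℂ) ((n : NNReal) / m) := by
        have hs : hsAdjoint Φ 1 = ((n : ℂ) / (m : ℂ)) • (1 : Matrix (Fin m) (Fin m) ℂ) := hΦ1.2
        rw [hs, Algebra.algebraMap_eq_smul_one, NNReal.smul_def, ← Complex.coe_smul]
        simp
      rw [CFC.one_rpow, Matrix.mul_one, e, CFC.rpow_algebraMap, Algebra.algebraMap_eq_smul_one,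
        NNReal.smul_def, Matrix.mul_smul, Matrix.mul_one, Matrix.trace_smul, Complex.smul_re,
        smul_eq_mul] at h
      simpa using h
  · have hs1 : s < 1 := by linarith
    have hrs : 0 < r - s := by linarith
    have h1s : 0 < 1 - s := by linarith
    have hr : 0 < r := by linarith
    set X := (Φ B).conjTranspose * A ^ s * Φ B with hXdef
    set Y := B.conjTranspose * (hsAdjoint Φ A) ^ s * B with hYdef
    obtain ⟨p, hp⟩ : ∃ p, p = r / s := ⟨_, rfl⟩
    obtain ⟨p', hp'⟩ : ∃ p', p' = r / (r - s) := ⟨_, rfl⟩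
    obtain ⟨q, hq⟩ : ∃ q, q = (1 - s) * r / (r - s) := ⟨_, rfl⟩
    -- With `C = X^e`, this exponent yields both `C^(1-s) = X^(p-1)` and, as `q = (1-s)p'` and
    -- `(p-1)p' = p`, `C^q = X^p`.
    obtain ⟨e, he⟩ : ∃ e, e = (p - 1) / (1 - s) := ⟨_, rfl⟩
    have hp1 : 1 < p := by rwa [hp, one_lt_div hs]
    have hpp : p.HolderConjugate p' := by
      rw [Real.holderConjugate_iff]
      exact ⟨hp1, by rw [hp, hp']; field_simp; ring⟩
    have hq1 : 1 ≤ q := by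
      rw [hq, one_le_div hrs]
      nlinarith
    have he0 : 0 ≤ e := he ▸ div_nonneg (by linarith) h1s.le
    have hC : (X ^ e).PosSemidef := Matrix.PosSemidef.rpow e
    have hX0 := Matrix.nonneg_iff_posSemidef.2 hX
    have hC1 : (X ^ e) ^ (1 - s) = X ^ (p - 1) := by
      rw [CFC.rpow_rpow_of_exponent_nonneg X e (1 - s) he0 h1s.le hX0, he,
        div_mul_cancel₀ _ h1s.ne']
    have hC2 : (X ^ e) ^ q = X ^ p := by
      rw [CFC.rpow_rpow_of_exponent_nonneg X e q he0 (by linarith) hX0, he, hp, hq]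
      congr 1
      field_simp
    have hD : (hsAdjoint Φ (X ^ e) ^ (1 - s)) ^ p' = hsAdjoint Φ (X ^ e) ^ q := by
      rw [CFC.rpow_rpow_of_exponent_nonneg _ _ _ h1s.le hpp.symm.nonneg
        (Matrix.nonneg_iff_posSemidef.2 (hΦ.posSemidef_hsAdjoint hC)), hp', hq, mul_div_assoc]
    have h1 := hΦ.trace_rpow_mul_rpow_le ⟨hs, hs1⟩ hA hC B
    rw [hC1, ← hXdef, ← hYdef, hX.mul_rpow_sub_one (by linarith)] at h1
    have h2 := hY.trace_mul_le_rpow_mul_rpow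
      (Matrix.PosSemidef.rpow (A := hsAdjoint Φ (X ^ e)) (1 - s)) hpp
    rw [hD] at h2
    have h3 := hΦ.trace_hsAdjoint_rpow_le hΦ1 hC hq1
    rw [hC2] at h3
    rw [← hp]
    refine le_mul_rpow_of_le_holder hs hsr hp hp' hq hN
      (Matrix.PosSemidef.trace_rpow_re_nonneg X p) (Matrix.PosSemidef.trace_rpow_re_nonneg Y p)
      (h1.trans (h2.trans ?_))
    exact mul_le_mul_of_nonneg_left
      (Real.rpow_le_rpow (Matrix.PosSemidef.trace_rpow_re_nonneg _ _) h3
        (one_div_nonneg.2 hpp.symm.nonneg))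
      (Real.rpow_nonneg (Matrix.PosSemidef.trace_rpow_re_nonneg _ _) _)
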